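/- Let $S^1=\mathbb R/2\pi\mathbb Z$ with the measure $d\theta$ of total mass $2\pi$, let $X=L^2(S^1;\mathbb R)$ with inner product $\langle f,g\rangle=\int_{S^1} fg\,d\theta$, and let $X^+=\{y\in X: y\ge 0\text{ a.e.}\}$. Let $A:S^1\to\mathbb R$ be measurable and bounded, and let $N:S^1\to[0,\infty)$ be measurable, bounded and not a.e. equal to $0$. Let $\mathcal A f=f''+A(\cdot)f$ with domain $D(\mathcal A)=W^{2,2}(S^1)$, a self-adjoint operator on $X$ with adjoint $\mathcal A^*$. Let $\lambda_0$ be the principal (largest) eigenvalue of $\mathcal A$, and let $e_0\in D(\mathcal A)$ satisfy $\mathcal A e_0=\lambda_0e_0$, $\|e_0\|=1$ and $e_0>0$ a.e. Let $\rho>0$ and $\sigma\in(0,1)\cup(1,\infty)$ with $\rho>\lambda_0(1-\sigma)$. For $u\in X^+$ put $\Psi(u)=\int_{S^1}\frac{u(\theta)^{1-\sigma}}{1-\sigma}N(\theta)\,d\theta\in[-\infty,\infty)$ (with $0^{1-\sigma}=+\infty$ if $\sigma>1$, and $\infty\cdot 0=0$), and consider the equation $$\rho v(x)=\langle x,\mathcal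 A^*Dv(x)\rangle+\sup_{u\in X^+}\bigl\{\Psi(u)-\langle uN,Dv(x)\rangle\bigr\},\tag{HJB}$$ where $Dv$ is the gradient of $v$. For $O\subseteq X$ open, $v$ is a classical solution of (HJB) on $O$ if $v\in C^1(O)$, $Dv(x)\in D(\mathcal A^*)$ for all $x\in O$, $Dv:O\to D(\mathcal A^*)$ is continuous for the graph norm, and (HJB) holds at every $x\in O$. Then $e_0^{1-1/\sigma}N$ is integrable on $S^1$. Define $$\alpha_0=\left(\frac{\sigma}{\rho-\lambda_0(1-\sigma)}\int_{S^1}e_0(\eta)^{1-\frac1\sigma}N(\eta)\,d\eta\right)^{\frac{\sigma}{1-\sigma}},\qquad \beta=\alpha_0e_0\in X,\qquad v(x)=\frac{\langle x,\beta\rangle^{1-\sigma}}{1-\sigma}.$$ Then $\beta>0$ a.e., and $v$ is a classical solution of (HJB) on the open half-space $\{x\in X:\langle x,e_0\rangle>0\}$. In particular $v$ is $C^1$ on the subset $X^+_{e_0}=\{x\in X^+:\langle x,e_0\rangle>0\}$ of this half-space, and at every $x\in X^+_{e_0}$ equation (HJB) holds; there, moreover, $Dv(x)\in D(\mathcal A)$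 and (HJB) holds also with $\mathcal A$ in place of $\mathcal A^*$. -/

import Mathlib

open MeasureTheory Set
open scoped ContDiff Gradient ENNReal

noncomputable section

/-! ### Classical solutions of stationary HJB equations in a Hilbert space -/

section Abstract

variable {E : Type*} [NormedAddCommGroup E] [InnerProductSpace ℝ E] [CompleteSpace E]

/-- The class `𝒮(O)`: functions that are continuously Fréchet differentiable on the open set `O`,
whose gradient takes values in the domain of the adjoint `𝒜†` and is continuous from `O` to that
domain with the graph norm. -/
structure MemClassS (𝒜 : E →ₗ.[ℝ] E) (O : Set E) (v : E → ℝ) : Prop where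
  isOpen : IsOpen O
  contDiffOn : ContDiffOn ℝ 1 v O
  gradient_mem : ∀ x ∈ O, ∇ v x ∈ 𝒜.adjoint.domain
  continuous_gradient : Continuous fun x : O => ∇ v (x : E)
  continuous_adjoint_gradient :
    Continuous fun x : O => 𝒜.adjoint ⟨∇ v (x : E), gradient_mem x x.2⟩

/-- `v` solves `ρ v(x) = ⟨x, 𝒜† Dv(x)⟩ + H(x, Dv(x))` at the point `x`, where `H` is an extended
real valued Hamiltonian. -/
def SolvesHJBAt (ρ : ℝ) (𝒜 : E →ₗ.[ℝ] E) (H : E → E → EReal) (v : E → ℝ) (x : E) : Prop :=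
  ∃ h : ∇ v x ∈ 𝒜.adjoint.domain,
    ((ρ * v x : ℝ) : EReal) = ((inner ℝ x (𝒜.adjoint ⟨∇ v x, h⟩) : ℝ) : EReal) + H x (∇ v x)

/-- Classical solutions on the open set `O`. -/
def IsClassicalHJBSolution (ρ : ℝ) (𝒜 : E →ₗ.[ℝ] E) (H : E → E → EReal) (O : Set E)
    (v : E → ℝ) : Prop :=
  MemClassS 𝒜 O v ∧ ∀ x ∈ O, SolvesHJBAt ρ 𝒜 H v x

end Abstract

/-! ### The spatial AK growth model on the circle -/

namespace SpatialAK

instance instFactTwoPiPos : Fact ((0 : ℝ) < 2 * Real.pi) := ⟨Real.two_pi_pos⟩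

/-- The circle `S¹ = ℝ / 2πℤ`, with the measure `dθ` of total mass `2π`. -/
abbrev S1 : Type := AddCircle (2 * Real.pi)

/-- The state space `X = L²(S¹; ℝ)`. -/
abbrev X : Type := Lp ℝ 2 (volume : Measure S1)

/-- `φ` is a `C^∞` function on the circle and `φ'` is its derivative. -/
def IsTestPair (φ φ' : C(S1, ℝ)) : Prop :=
  ContDiff ℝ ∞ (fun t : ℝ => φ (t : S1)) ∧
    ∀ t : ℝ, HasDerivAt (fun s : ℝ => φ (s : S1)) (φ' (t : S1)) t

/-- `g` is the weak derivative of `f` on the circle. -/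
def IsWeakDeriv (f g : X) : Prop :=
  ∀ φ φ' : C(S1, ℝ), IsTestPair φ φ' → ∫ θ, f θ * φ' θ = -∫ θ, g θ * φ θ

theorem integrable_mul_continuous (f : X) (φ : C(S1, ℝ)) :
    Integrable (fun θ => f θ * φ θ) (volume : Measure S1) := by
  have hf : Integrable f (volume : Measure S1) := (Lp.memLp f).integrable (by norm_num)
  refine hf.mul_bdd (c := ‖φ‖) φ.continuous.aestronglyMeasurable ?_
  exact Filter.Eventually.of_forall fun θ => φ.norm_coe_le_norm θ

theorem integral_add_mul (f g : X) (φ : C(S1, ℝ)) :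
    ∫ θ, (f + g : X) θ * φ θ = (∫ θ, f θ * φ θ) + ∫ θ, g θ * φ θ := by
  rw [← integral_add (integrable_mul_continuous f φ) (integrable_mul_continuous g φ)]
  refine integral_congr_ae ?_
  filter_upwards [Lp.coeFn_add f g] with θ h
  rw [h, Pi.add_apply, add_mul]

theorem integral_smul_mul (c : ℝ) (f : X) (φ : C(S1, ℝ)) :
    ∫ θ, (c • f : X) θ * φ θ = c * ∫ θ, f θ * φ θ := by
  rw [← integral_const_mul]
  refine integral_congr_ae ?_
  filter_upwards [Lp.coeFn_smul c f] with θ h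
  rw [h, Pi.smul_apply, smul_eq_mul, mul_assoc]

theorem IsWeakDeriv.add {f₁ f₂ g₁ g₂ : X} (h₁ : IsWeakDeriv f₁ g₁) (h₂ : IsWeakDeriv f₂ g₂) :
    IsWeakDeriv (f₁ + f₂) (g₁ + g₂) := by
  intro φ φ' hφ
  rw [integral_add_mul, integral_add_mul, h₁ φ φ' hφ, h₂ φ φ' hφ]
  ring

theorem IsWeakDeriv.smul (c : ℝ) {f g : X} (h : IsWeakDeriv f g) :
    IsWeakDeriv (c • f) (c • g) := by
  intro φ φ' hφ
  rw [integral_smul_mul, integral_smul_mul, h φ φ' hφ]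
  ring

/-- The graph of `𝒜 f = f'' + A(·) f`: the pairs `(f, k)` with `f ∈ W^{2,2}(S¹)` and
`k = f'' + A f` almost everywhere. -/
def opGraph (A : S1 → ℝ) : Submodule ℝ (X × X) where
  carrier := {p | ∃ f' f'' : X, IsWeakDeriv p.1 f' ∧ IsWeakDeriv f' f'' ∧
    ∀ᵐ θ, p.2 θ = f'' θ + A θ * p.1 θ}
  zero_mem' := by
    have h0 : IsWeakDeriv 0 0 := by
      intro φ φ' _
      have h := fun ψ => integral_smul_mul 0 0 ψ
      simp only [zero_smul, zero_mul] at h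
      rw [h, h, neg_zero]
    refine ⟨0, 0, h0, h0, ?_⟩
    exact Filter.Eventually.of_forall fun θ => by simp
  add_mem' := by
    rintro ⟨f, k⟩ ⟨g, l⟩ ⟨f', f'', h1, h2, h3⟩ ⟨g', g'', h4, h5, h6⟩
    refine ⟨f' + g', f'' + g'', h1.add h4, h2.add h5, ?_⟩
    filter_upwards [h3, h6, Lp.coeFn_add f g, Lp.coeFn_add k l, Lp.coeFn_add f'' g'']
      with θ a b c d e
    simp only [Prod.mk_add_mk, c, d, e, Pi.add_apply, a, b]
    ring
  smul_mem' := by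
    rintro c ⟨f, k⟩ ⟨f', f'', h1, h2, h3⟩
    refine ⟨c • f', c • f'', h1.smul c, h2.smul c, ?_⟩
    filter_upwards [h3, Lp.coeFn_smul c f, Lp.coeFn_smul c k, Lp.coeFn_smul c f''] with θ a b d e
    simp only [Prod.smul_mk, b, d, e, Pi.smul_apply, a, smul_eq_mul]
    ring

/-- The operator `𝒜 f = f'' + A(·) f` on `X`, with domain `D(𝒜) = W^{2,2}(S¹)` when `A` is
bounded and measurable. -/
def op (A : S1 → ℝ) : X →ₗ.[ℝ] X := (opGraph A).toLinearPMap

/-- Smooth functions on the circle, as a subalgebra of the continuous ones. -/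
def smoothSubalgebra : Subalgebra ℝ C(S1, ℝ) where
  carrier := {φ | ContDiff ℝ ∞ (fun t : ℝ => φ (t : S1))}
  mul_mem' h₁ h₂ := by
    simp only [Set.mem_ofPred_eq] at *
    exact h₁.mul h₂
  add_mem' h₁ h₂ := by
    simp only [Set.mem_ofPred_eq] at *
    exact h₁.add h₂
  algebraMap_mem' _ := by
    simp only [Set.mem_ofPred_eq]
    exact contDiff_const

theorem mem_smoothSubalgebra {φ : C(S1, ℝ)} :
    φ ∈ smoothSubalgebra ↔ ContDiff ℝ ∞ (fun t : ℝ => φ (t : S1)) := by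
  change φ ∈ {φ : C(S1, ℝ) | ContDiff ℝ ∞ (fun t : ℝ => φ (t : S1))} ↔ _
  rw [Set.mem_ofPred_eq]

theorem smoothSubalgebra_separatesPoints : smoothSubalgebra.SeparatesPoints := by
  intro x y hxy
  by_contra hcon
  push Not at hcon
  have hc : (fun θ : S1 => Real.Angle.cos θ) x = (fun θ : S1 => Real.Angle.cos θ) y :=
    hcon _ ⟨⟨fun θ : S1 => Real.Angle.cos θ, Real.Angle.continuous_cos⟩,
      mem_smoothSubalgebra.2 Real.contDiff_cos, rfl⟩
  have hs : (fun θ : S1 => Real.Angle.sin θ) x = (fun θ : S1 => Real.Angle.sin θ) y :=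
    hcon _ ⟨⟨fun θ : S1 => Real.Angle.sin θ, Real.Angle.continuous_sin⟩,
      mem_smoothSubalgebra.2 Real.contDiff_sin, rfl⟩
  induction x using QuotientAddGroup.induction_on with | _ a
  induction y using QuotientAddGroup.induction_on with | _ b
  exact hxy (Real.Angle.cos_sin_inj hc hs)

/-- Every smooth function on the circle is the first member of a test pair. -/
theorem exists_isTestPair {φ : C(S1, ℝ)} (hφ : φ ∈ smoothSubalgebra) :
    ∃ φ' : C(S1, ℝ), IsTestPair φ φ' := by
  have hφ' : ContDiff ℝ ∞ (fun t : ℝ => φ (t : S1)) := mem_smoothSubalgebra.1 hφ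
  have hper : Function.Periodic (deriv fun t : ℝ => φ (t : S1)) (2 * Real.pi) := by
    intro t
    rw [← deriv_comp_add_const]
    congr 1
    ext s
    simp
  have hcont : Continuous (deriv fun t : ℝ => φ (t : S1)) :=
    hφ'.continuous_deriv (by simp)
  refine ⟨⟨hper.lift, ?_⟩, hφ', fun t => ?_⟩
  · exact continuous_coinduced_dom.mpr hcont
  · exact (hφ'.differentiable (by simp) t).hasDerivAt

theorem eq_zero_of_integral_mul_eq_zero (g : X)
    (h : ∀ φ φ' : C(S1, ℝ), IsTestPair φ φ' → ∫ θ, g θ * φ θ = 0) : g = 0 := by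
  have hin : ∀ φ : C(S1, ℝ),
      inner ℝ (ContinuousMap.toLp 2 (volume : Measure S1) ℝ φ) g = ∫ θ, g θ * φ θ := by
    intro φ
    rw [L2.inner_def]
    refine integral_congr_ae ?_
    filter_upwards [ContinuousMap.coeFn_toLp (p := 2) (volume : Measure S1) (𝕜 := ℝ) φ] with θ e
    rw [e]
    simp
  have hdense : Dense (smoothSubalgebra : Set C(S1, ℝ)) := by
    have := ContinuousMap.subalgebra_topologicalClosure_eq_top_of_separatesPoints _
      smoothSubalgebra_separatesPoints
    intro φ
    have h2 : φ ∈ smoothSubalgebra.topologicalClosure := by rw [this]; trivial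
    exact h2
  have hall : ∀ φ : C(S1, ℝ),
      inner ℝ (ContinuousMap.toLp 2 (volume : Measure S1) ℝ φ) g = 0 := by
    have hclosed : IsClosed {φ : C(S1, ℝ) |
        inner ℝ (ContinuousMap.toLp 2 (volume : Measure S1) ℝ φ) g = 0} :=
      isClosed_eq ((ContinuousLinearMap.continuous _).inner continuous_const) continuous_const
    intro φ
    refine closure_minimal (s := (smoothSubalgebra : Set C(S1, ℝ))) ?_ hclosed (hdense φ)
    intro ψ hψ
    obtain ⟨ψ', hp⟩ := exists_isTestPair hψ
    exact (hin ψ).trans (h ψ ψ' hp)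
  have hd : DenseRange (ContinuousMap.toLp 2 (volume : Measure S1) ℝ : C(S1, ℝ) →L[ℝ] X) :=
    ContinuousMap.toLp_denseRange ℝ volume ℝ (by norm_num)
  refine hd.eq_zero_of_inner_left ℝ fun φ => ?_
  rw [real_inner_comm]
  exact hall φ

/-- Weak derivatives are unique, so `op A` has exactly the prescribed graph. -/
theorem op_graph (A : S1 → ℝ) : (op A).graph = opGraph A := by
  refine Submodule.toLinearPMap_graph_eq _ ?_
  have key : ∀ f g : X, IsWeakDeriv f g → f = 0 → g = 0 := by
    rintro f g hfg rfl
    refine eq_zero_of_integral_mul_eq_zero g fun φ φ' hφ => ?_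
    have h0 : ∫ θ, (0 : X) θ * φ' θ = 0 := by
      have := integral_smul_mul 0 0 φ'
      simpa only [zero_smul, zero_mul] using this
    have := hfg φ φ' hφ
    linarith
  rintro ⟨f, k⟩ ⟨f', f'', h1, h2, h3⟩ hf
  have hf0 : f = 0 := hf
  subst hf0
  have h4 : f'' = 0 := key _ _ h2 (key _ _ h1 rfl)
  subst h4
  refine Lp.ext ?_
  filter_upwards [h3, Lp.coeFn_zero ℝ 2 (volume : Measure S1)] with θ a b
  simpa [b] using a

/-- `lam` is an eigenvalue of `𝒜` with eigenvector `e`. -/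
def IsEigenpair (A : S1 → ℝ) (lam : ℝ) (e : X) : Prop :=
  e ≠ 0 ∧ ∃ h : e ∈ (op A).domain, op A ⟨e, h⟩ = lam • e

/-- `lam` is the principal, i.e. largest, eigenvalue of `𝒜`. -/
def IsPrincipalEigenvalue (A : S1 → ℝ) (lam : ℝ) : Prop :=
  IsGreatest {μ : ℝ | ∃ e : X, IsEigenpair A μ e} lam

/-- The positive cone `X⁺`. -/
def posCone : Set X := {y | ∀ᵐ θ, 0 ≤ y θ}

/-- The set `X⁺_{e₀}` of the `y ∈ X⁺` with `⟨y, e₀⟩ > 0`. -/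
def posConeOf (e₀ : X) : Set X := {y | y ∈ posCone ∧ 0 < (inner ℝ y e₀ : ℝ)}

/-- The open half-space of the `y ∈ X` with `⟨y, e₀⟩ > 0`. -/
def halfSpace (e₀ : X) : Set X := {y | 0 < (inner ℝ y e₀ : ℝ)}

/-- `Ψ(u) = ∫ u^{1-σ}/(1-σ) N dθ` for `u ∈ X⁺`, with values in `[-∞, ∞]`: for `σ > 1` one has
`0^{1-σ} = ∞`, and `Ψ(u) = -∞` when the integral of `u^{1-σ} N` diverges. -/
def utility (σ : ℝ) (N : S1 → ℝ) (u : X) : EReal :=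
  ((1 / (1 - σ) : ℝ) : EReal) *
    ((∫⁻ θ, ENNReal.ofReal (u θ) ^ (1 - σ) * ENNReal.ofReal (N θ) : ℝ≥0∞) : EReal)

/-- The Hamiltonian `sup_{u ∈ X⁺} (Ψ(u) - ⟨u N, p⟩)`. -/
def hamiltonian (σ : ℝ) (N : S1 → ℝ) (p : X) : EReal :=
  ⨆ u ∈ posCone, (utility σ N u - ((∫ θ, u θ * N θ * p θ : ℝ) : EReal))

/-- The integral of `e₀^{1-1/σ} N` over the circle. -/
def weightIntegral (σ : ℝ) (N : S1 → ℝ) (e₀ : X) : ℝ :=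
  ∫ η, e₀ η ^ (1 - 1 / σ) * N η

/-- The constant `α₀`. -/
def alpha0 (ρ σ lam0 : ℝ) (N : S1 → ℝ) (e₀ : X) : ℝ :=
  (σ / (ρ - lam0 * (1 - σ)) * weightIntegral σ N e₀) ^ (σ / (1 - σ))

/-- The function `β = α₀ e₀`. -/
def beta (ρ σ lam0 : ℝ) (N : S1 → ℝ) (e₀ : X) : X := alpha0 ρ σ lam0 N e₀ • e₀

/-- The explicit solution `v(x) = ⟨x, β⟩^{1-σ} / (1-σ)`. -/
def explicitSol (ρ σ lam0 : ℝ) (N : S1 → ℝ) (e₀ : X) (x : X) : ℝ :=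
  (inner ℝ x (beta ρ σ lam0 N e₀) : ℝ) ^ (1 - σ) / (1 - σ)

end SpatialAK

end

/-!
The gradient of `v` is `Dv(x) = ⟨x, β⟩^{-σ} β`, a positive multiple of the eigenfunction `e₀`. So
the equation only has to be understood along the ray spanned by `e₀`, where `𝒜†` is multiplication
by `λ₀` and the Hamiltonian is explicit:

* `𝒜` is symmetric. A function with a weak derivative in `L²` has a continuous representative that
  is a primitive of that derivative (`IsWeakDeriv.exists_isPrimitive`), hence absolutely continuous,
  and integration by parts applies (`IsWeakDeriv.integral_mul`). The domain contains the smooth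
  functions, so it is dense, and `𝒜` is contained in its adjoint (`op_le_adjoint`). This puts
  `Dv(x)` into `D(𝒜†)`, with `𝒜† Dv(x) = λ₀ Dv(x)`.
* `e₀` is bounded, and bounded away from `0` (`IsEigenpair.exists_bounds`). Its representative is
  continuously differentiable and satisfies `e₀'' = (λ₀ - A) e₀` almost everywhere; if it vanished
  somewhere, that point would be a minimum, and a Gronwall argument would give `e₀ = 0`
  (`eq_zero_of_deriv_le_mul_integral`). In particular all powers of `e₀` are bounded.
* For `p` bounded and bounded away from `0`, maximizing `u^{1-σ}/(1-σ) - u p` pointwise gives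
  `u = p^{-1/σ}`, which is bounded and so belongs to `X`. The Hamiltonian therefore equals
  `σ/(1-σ) ∫ p^{1-1/σ} N` (`hamiltonian_eq`).

Inserting `p = Dv(x)`, both sides of the equation are multiples of `⟨x, β⟩^{1-σ}/(1-σ)`, and
`α₀` is the constant for which they agree (`hamiltonian_coefficient`).
-/

namespace SpatialAK

/-! ### Weak derivatives on the circle and their primitives -/

theorem ae_coe_of_ae {P : S1 → Prop} (h : ∀ᵐ θ, P θ) : ∀ᵐ t : ℝ, P (t : S1) := by
  rw [← Measure.restrict_univ (μ := (volume : Measure ℝ)),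
    ← iUnion_Ioc_add_zsmul Real.two_pi_pos 0, ae_restrict_iUnion_iff]
  intro n
  have h1 := (AddCircle.measurePreserving_mk (2 * Real.pi)
    (0 + n • (2 * Real.pi))).quasiMeasurePreserving.ae h
  rw [add_smul, one_smul, ← add_assoc]
  exact h1

theorem intervalIntegrable_coe {g : S1 → ℝ} (hg : Integrable g) (a b : ℝ) :
    IntervalIntegrable (fun t : ℝ => g (t : S1)) volume a b := by
  have hper : Function.Periodic (fun t : ℝ => g (t : S1)) (2 * Real.pi) := fun t => by simp
  refine hper.intervalIntegrable₀ Real.two_pi_pos.ne' ?_ a b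
  rw [intervalIntegrable_iff_integrableOn_Ioc_of_le Real.two_pi_pos.le]
  have h := (AddCircle.measurePreserving_mk (2 * Real.pi) 0).integrable_comp_of_integrable hg
  rw [zero_add] at h
  exact h

theorem integrable_continuousMap (φ : C(S1, ℝ)) : Integrable (φ : S1 → ℝ) :=
  φ.continuous.integrable_of_hasCompactSupport (HasCompactSupport.of_compactSpace _)

theorem integrable_coeFn (f : X) : Integrable (f : S1 → ℝ) :=
  (Lp.memLp f).integrable (by norm_num)

/-- The continuous function `F` on the circle is a primitive of `g`. For integrable `g` this says
that `F` is absolutely continuous with derivative `g` almost everywhere. -/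
def IsPrimitive (F : C(S1, ℝ)) (g : S1 → ℝ) : Prop :=
  ∀ s t : ℝ, F (t : S1) - F (s : S1) = ∫ x in s..t, g (x : S1)

theorem IsTestPair.isPrimitive {φ φ' : C(S1, ℝ)} (h : IsTestPair φ φ') : IsPrimitive φ φ' := by
  intro s t
  refine (intervalIntegral.integral_eq_sub_of_hasDerivAt (fun x _ => h.2 x) ?_).symm
  exact (φ'.continuous.comp (AddCircle.continuous_mk' _)).intervalIntegrable s t

/-- Integration by parts on the circle; there are no boundary terms. -/
theorem IsPrimitive.integral_mul {F G : C(S1, ℝ)} {g k : S1 → ℝ} (hF : IsPrimitive F g)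
    (hG : IsPrimitive G k) (hg : Integrable g) (hk : Integrable k) :
    ∫ θ, F θ * k θ = -∫ θ, g θ * G θ := by
  have key : ∀ {F : C(S1, ℝ)} {g : S1 → ℝ}, IsPrimitive F g → Integrable g →
      AbsolutelyContinuousOnInterval (fun t : ℝ => F (t : S1)) 0 (0 + 2 * Real.pi) ∧
      ∀ᵐ t : ℝ, t ∈ uIcc 0 (0 + 2 * Real.pi) →
        deriv (fun t : ℝ => F (t : S1)) t = g (t : S1) := by
    intro F g hF hg
    have hi := intervalIntegrable_coe hg 0 (0 + 2 * Real.pi)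
    have e : (fun t : ℝ => F (t : S1)) =
        fun t : ℝ => F ((0 : ℝ) : S1) + ∫ x in (0 : ℝ)..t, g (x : S1) := by
      ext t
      rw [← hF 0 t]
      ring
    refine ⟨?_, ?_⟩
    · rw [e]
      have hc : AbsolutelyContinuousOnInterval (fun _ : ℝ => F ((0 : ℝ) : S1)) 0
          (0 + 2 * Real.pi) :=
        (LipschitzWith.const _).lipschitzOnWith.absolutelyContinuousOnInterval
      exact hc.fun_add (hi.absolutelyContinuousOnInterval_intervalIntegral (by simp))
    · rw [e]
      filter_upwards [hi.ae_hasDerivAt_integral] with t ht hmem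
      exact ((ht hmem 0 (by simp)).const_add _).deriv
  obtain ⟨acF, dF⟩ := key hF hg
  obtain ⟨acG, dG⟩ := key hG hk
  have h := acF.integral_mul_deriv_eq_deriv_mul acG
  have hend : (((0 : ℝ) + 2 * Real.pi : ℝ) : S1) = ((0 : ℝ) : S1) := by simp
  rw [hend, sub_self, zero_sub] at h
  rw [← AddCircle.intervalIntegral_preimage (2 * Real.pi) 0,
    ← AddCircle.intervalIntegral_preimage (2 * Real.pi) 0]
  refine Eq.trans ?_ (h.trans (congrArg Neg.neg ?_)) <;>
    refine intervalIntegral.integral_congr_ae ?_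
  · filter_upwards [dG] with t ht hmem
    rw [ht (uIoc_subset_uIcc hmem)]
  · filter_upwards [dF] with t ht hmem
    rw [ht (uIoc_subset_uIcc hmem)]

/-- Every integrable function on the circle with mean zero has a continuous primitive. -/
theorem exists_isPrimitive {g : S1 → ℝ} (hg : Integrable g) (h0 : ∫ θ, g θ = 0) :
    ∃ F : C(S1, ℝ), IsPrimitive F g := by
  have hi := intervalIntegrable_coe hg
  have hper : Function.Periodic (fun t : ℝ => ∫ x in (0 : ℝ)..t, g (x : S1)) (2 * Real.pi) := by
    intro t
    change ∫ x in (0 : ℝ)..(t + 2 * Real.pi), g (x : S1) = ∫ x in (0 : ℝ)..t, g (x : S1)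
    rw [← intervalIntegral.integral_add_adjacent_intervals (hi 0 t) (hi t _),
      AddCircle.intervalIntegral_preimage (2 * Real.pi) t, h0, add_zero]
  have hc : Continuous fun t : ℝ => ∫ x in (0 : ℝ)..t, g (x : S1) :=
    intervalIntegral.continuous_primitive hi 0
  refine ⟨⟨hper.lift, continuous_coinduced_dom.mpr hc⟩, fun s t => ?_⟩
  change (∫ x in (0 : ℝ)..t, g (x : S1)) - (∫ x in (0 : ℝ)..s, g (x : S1)) = _
  rw [intervalIntegral.integral_interval_sub_left (hi 0 t) (hi 0 s)]

theorem isTestPair_const (c : ℝ) : IsTestPair (ContinuousMap.const S1 c) 0 :=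
  ⟨contDiff_const, fun t => hasDerivAt_const t c⟩

/-- Every smooth function with mean zero is the derivative of a smooth function. -/
theorem exists_isTestPair_of_integral_eq_zero {φ : C(S1, ℝ)}
    (hφ : ContDiff ℝ ∞ (fun t : ℝ => φ (t : S1))) (h0 : ∫ θ, φ θ = 0) :
    ∃ ψ : C(S1, ℝ), IsTestPair ψ φ := by
  obtain ⟨ψ, hψ⟩ := exists_isPrimitive (integrable_continuousMap φ) h0
  have hd : ∀ t : ℝ, HasDerivAt (fun s : ℝ => ψ (s : S1)) (φ (t : S1)) t := by
    intro t
    have e : (fun t : ℝ => ψ (t : S1)) =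
        fun t : ℝ => ψ ((0 : ℝ) : S1) + ∫ x in (0 : ℝ)..t, φ (x : S1) := by
      ext t
      rw [← hψ 0 t]
      ring
    rw [e]
    exact ((hφ.continuous.integral_hasStrictDerivAt 0 t).hasDerivAt).const_add _
  refine ⟨ψ, ?_, hd⟩
  rw [contDiff_infty_iff_deriv]
  refine ⟨fun t => (hd t).differentiableAt, ?_⟩
  rw [show deriv (fun s : ℝ => ψ (s : S1)) = fun t : ℝ => φ (t : S1) from
    funext fun t => (hd t).deriv]
  exact hφ

theorem IsWeakDeriv.integral_eq_zero {f g : X} (h : IsWeakDeriv f g) : ∫ θ, g θ = 0 := by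
  have := h _ _ (isTestPair_const 1)
  simpa using this

/-- A function in `L²` whose weak derivative vanishes is constant. -/
theorem ae_eq_const_of_integral_mul_eq_zero {h : X}
    (hh : ∀ φ φ' : C(S1, ℝ), IsTestPair φ φ' → ∫ θ, h θ * φ' θ = 0) :
    ∃ c : ℝ, ∀ᵐ θ, h θ = c := by
  set c : ℝ := (2 * Real.pi)⁻¹ * ∫ θ, h θ with hc
  have hvol : (volume : Measure S1).real univ = 2 * Real.pi := by
    rw [measureReal_def, AddCircle.measure_univ, ENNReal.toReal_ofReal Real.two_pi_pos.le]
  have hpi := Real.two_pi_pos.ne'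
  let C : X := ContinuousMap.toLp 2 (volume : Measure S1) ℝ (ContinuousMap.const S1 c)
  have hC : ∀ᵐ θ, C θ = c := ContinuousMap.coeFn_toLp (p := 2) (volume : Measure S1) (𝕜 := ℝ) _
  have hz : h - C = 0 := by
    refine eq_zero_of_integral_mul_eq_zero _ fun φ φ' hφ => ?_
    set m : ℝ := (2 * Real.pi)⁻¹ * ∫ θ, φ θ with hm
    -- only functions with mean zero are derivatives of functions on the circle
    obtain ⟨ψ, hψ⟩ := exists_isTestPair_of_integral_eq_zero (φ := φ - ContinuousMap.const S1 m)
      (hφ.1.sub contDiff_const) (by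
        change ∫ θ, (φ θ - m) = 0
        rw [integral_sub (integrable_continuousMap φ) (integrable_const m), integral_const,
          hvol, smul_eq_mul, hm]
        field_simp
        ring)
    have h1 : ∫ θ, h θ * (φ θ - m) = 0 := hh _ _ hψ
    have h2 : ∫ θ, h θ * (φ θ - m) = (∫ θ, h θ * φ θ) - (∫ θ, h θ) * m := by
      rw [← integral_mul_const, ← integral_sub (integrable_mul_continuous h φ)
        ((integrable_coeFn h).mul_const m)]
      exact integral_congr_ae (.of_forall fun θ => by ring)
    have h3 : ∫ θ, (h - C : X) θ * φ θ = (∫ θ, h θ * φ θ) - c * ∫ θ, φ θ := by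
      rw [← integral_const_mul, ← integral_sub (integrable_mul_continuous h φ)
        ((integrable_continuousMap φ).const_mul c)]
      refine integral_congr_ae ?_
      filter_upwards [Lp.coeFn_sub h C, hC] with θ a b
      rw [a, Pi.sub_apply, b]
      ring
    rw [h3, hc]
    rw [h2, hm] at h1
    linarith
  refine ⟨c, ?_⟩
  filter_upwards [Lp.coeFn_sub h C, hC, Lp.coeFn_zero ℝ 2 (volume : Measure S1)] with θ a b d
  rw [hz, d, Pi.sub_apply, b, Pi.zero_apply] at a
  linarith

/-- A weakly differentiable function has a continuous representative, and that representative is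
a primitive of the weak derivative. -/
theorem IsWeakDeriv.exists_isPrimitive {f g : X} (h : IsWeakDeriv f g) :
    ∃ F : C(S1, ℝ), (∀ᵐ θ, f θ = F θ) ∧ IsPrimitive F g := by
  obtain ⟨F, hF⟩ := SpatialAK.exists_isPrimitive (integrable_coeFn g) h.integral_eq_zero
  let F₁ : X := ContinuousMap.toLp 2 (volume : Measure S1) ℝ F
  have hF₁ : ∀ᵐ θ, F₁ θ = F θ :=
    ContinuousMap.coeFn_toLp (p := 2) (volume : Measure S1) (𝕜 := ℝ) _
  obtain ⟨c, hc⟩ := ae_eq_const_of_integral_mul_eq_zero (h := f - F₁) (by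
    intro φ φ' hφ
    have h1 := hF.integral_mul hφ.isPrimitive (integrable_coeFn g) (integrable_continuousMap φ')
    have h2 : ∫ θ, (f - F₁ : X) θ * φ' θ = (∫ θ, f θ * φ' θ) - ∫ θ, F₁ θ * φ' θ := by
      rw [← integral_sub (integrable_mul_continuous f φ') (integrable_mul_continuous F₁ φ')]
      refine integral_congr_ae ?_
      filter_upwards [Lp.coeFn_sub f F₁] with θ a
      rw [a, Pi.sub_apply, sub_mul]
    have h3 : ∫ θ, F₁ θ * φ' θ = ∫ θ, F θ * φ' θ :=
      integral_congr_ae (hF₁.mono fun θ hθ => by simp only [hθ])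
    rw [h2, h3, h1, h φ φ' hφ, sub_self])
  refine ⟨F + ContinuousMap.const S1 c, ?_, fun s t => ?_⟩
  · filter_upwards [hc, hF₁, Lp.coeFn_sub f F₁] with θ a b d
    rw [d, Pi.sub_apply, b] at a
    simp only [ContinuousMap.add_apply, ContinuousMap.const_apply]
    linarith
  · simpa using hF s t

/-- Integration by parts for weakly differentiable functions. -/
theorem IsWeakDeriv.integral_mul {f f' g g' : X} (hf : IsWeakDeriv f f') (hg : IsWeakDeriv g g') :
    ∫ θ, f θ * g' θ = -∫ θ, f' θ * g θ := by
  obtain ⟨F, hfF, hF⟩ := hf.exists_isPrimitive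
  obtain ⟨G, hgG, hG⟩ := hg.exists_isPrimitive
  refine Eq.trans ?_ ((hF.integral_mul hG (integrable_coeFn f') (integrable_coeFn g')).trans
    (congrArg Neg.neg ?_))
  · exact integral_congr_ae (hfF.mono fun θ hθ => by simp only [hθ])
  · exact integral_congr_ae (hgG.mono fun θ hθ => by simp only [hθ])

/-! ### The operator and its adjoint -/

theorem mem_op_domain_iff {A : S1 → ℝ} {f : X} :
    f ∈ (op A).domain ↔ ∃ k : X, (f, k) ∈ opGraph A := by
  rw [LinearPMap.mem_domain_iff, op_graph]

theorem op_apply_mem_opGraph (A : S1 → ℝ) (f : (op A).domain) :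
    ((f : X), op A f) ∈ opGraph A := by
  rw [← op_graph]
  exact LinearPMap.mem_graph _ _

/-- The domain is dense because it contains the smooth functions. -/
theorem dense_op_domain {A : S1 → ℝ} (hA : Measurable A) (hA_bdd : ∃ C : ℝ, ∀ θ, |A θ| ≤ C) :
    Dense ((op A).domain : Set X) := by
  obtain ⟨C, hC⟩ := hA_bdd
  refine Submodule.dense_iff_topologicalClosure_eq_top.2 ?_
  rw [Submodule.topologicalClosure_eq_top_iff, Submodule.eq_bot_iff]
  intro g hg
  refine eq_zero_of_integral_mul_eq_zero g fun φ φ' hφ => ?_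
  let T : C(S1, ℝ) → X := fun φ => ContinuousMap.toLp 2 (volume : Measure S1) ℝ φ
  have hT : ∀ φ : C(S1, ℝ), ∀ᵐ θ, T φ θ = φ θ := fun φ =>
    ContinuousMap.coeFn_toLp (p := 2) (volume : Measure S1) (𝕜 := ℝ) φ
  have hw : ∀ {φ φ' : C(S1, ℝ)}, IsTestPair φ φ' → IsWeakDeriv (T φ) (T φ') := by
    intro φ φ' hφ χ χ' hχ
    refine Eq.trans ?_ ((hφ.isPrimitive.integral_mul hχ.isPrimitive (integrable_continuousMap _)
      (integrable_continuousMap _)).trans (congrArg Neg.neg ?_))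
    · exact integral_congr_ae ((hT φ).mono fun θ hθ => by simp only [hθ])
    · exact integral_congr_ae ((hT φ').mono fun θ hθ => by simp only [hθ])
  have hφ's : φ' ∈ smoothSubalgebra := by
    rw [mem_smoothSubalgebra]
    have h := (contDiff_infty_iff_deriv.1 hφ.1).2
    rwa [show deriv (fun s : ℝ => φ (s : S1)) = fun t : ℝ => φ' (t : S1) from
      funext fun t => (hφ.2 t).deriv] at h
  obtain ⟨φ'', hφ'⟩ := exists_isTestPair hφ's
  have hk : MemLp (fun θ => φ'' θ + A θ * φ θ) 2 (volume : Measure S1) := by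
    refine MemLp.of_bound (C := ‖φ''‖ + C * ‖φ‖) ?_ (.of_forall fun θ => ?_)
    · exact (φ''.continuous.measurable.add (hA.mul φ.continuous.measurable)).aestronglyMeasurable
    · refine (norm_add_le _ _).trans (add_le_add (φ''.norm_coe_le_norm θ) ?_)
      rw [norm_mul]
      exact mul_le_mul (hC θ) (φ.norm_coe_le_norm θ) (norm_nonneg _) ((abs_nonneg _).trans (hC θ))
  have hmem : T φ ∈ (op A).domain := by
    refine mem_op_domain_iff.2 ⟨hk.toLp _, T φ', T φ'', hw hφ, hw hφ', ?_⟩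
    filter_upwards [hk.coeFn_toLp, hT φ, hT φ''] with θ a b c
    rw [a, b, c]
  have h0 := (Submodule.mem_orthogonal _ g).1 hg _ hmem
  rw [L2.inner_def] at h0
  rw [← h0]
  refine integral_congr_ae ?_
  filter_upwards [hT φ] with θ a
  rw [a]
  simp

/-- `𝒜` is symmetric: integrate by parts twice. -/
theorem op_isFormalAdjoint {A : S1 → ℝ} (hA : Measurable A)
    (hA_bdd : ∃ C : ℝ, ∀ θ, |A θ| ≤ C) : (op A).IsFormalAdjoint (op A) := by
  obtain ⟨C, hC⟩ := hA_bdd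
  intro f g
  obtain ⟨f', f'', hf1, hf2, hf3⟩ := op_apply_mem_opGraph A f
  obtain ⟨g', g'', hg1, hg2, hg3⟩ := op_apply_mem_opGraph A g
  have hmul : ∀ u w : X, Integrable fun θ => u θ * w θ := fun u w =>
    (Lp.memLp u).integrable_mul (Lp.memLp w)
  have hAm : Integrable fun θ => A θ * ((f : X) θ * (g : X) θ) :=
    (hmul f g).bdd_mul (c := C) hA.aestronglyMeasurable (.of_forall hC)
  have e1 : inner ℝ (op A f) (g : X) =
      (∫ θ, f'' θ * (g : X) θ) + ∫ θ, A θ * ((f : X) θ * (g : X) θ) := by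
    rw [L2.inner_def, ← integral_add (hmul _ _) hAm]
    refine integral_congr_ae ?_
    filter_upwards [hf3] with θ a
    rw [a]
    simp
    ring
  have e2 : inner ℝ (f : X) (op A g) =
      (∫ θ, (f : X) θ * g'' θ) + ∫ θ, A θ * ((f : X) θ * (g : X) θ) := by
    rw [L2.inner_def, ← integral_add (hmul _ _) hAm]
    refine integral_congr_ae ?_
    filter_upwards [hg3] with θ a
    rw [a]
    simp
    ring
  have e3 := hf1.integral_mul hg2
  have e4 := hf2.integral_mul hg1
  rw [e1, e2, e3, e4, neg_neg]

theorem op_le_adjoint {A : S1 → ℝ} (hA : Measurable A) (hA_bdd : ∃ C : ℝ, ∀ θ, |A θ| ≤ C) :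
    op A ≤ (op A).adjoint :=
  (op_isFormalAdjoint hA hA_bdd).le_adjoint (dense_op_domain hA hA_bdd)

/-! ### Strict positivity of nonnegative eigenfunctions -/

/-- A nonnegative solution of `F'' ≤ K F` that vanishes together with its derivative at `a` vanishes
after `a`. The inequality is used in the integrated form `F' ≤ K ∫ F`, so that
`Z = F + K ∫ F` satisfies `Z' ≤ K Z` and starts from `0`. -/
theorem eq_zero_of_deriv_le_mul_integral {F D : ℝ → ℝ} {K a : ℝ} (hK : 1 ≤ K)
    (hFc : Continuous F) (hF0 : ∀ t, 0 ≤ F t) (hF : ∀ t, HasDerivAt F (D t) t) (ha : F a = 0)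
    (hD : ∀ t, a ≤ t → D t ≤ K * ∫ x in a..t, F x) {t : ℝ} (ht : a ≤ t) : F t = 0 := by
  have hI : ∀ t, HasDerivAt (fun t => ∫ x in a..t, F x) (F t) t := fun t =>
    (hFc.integral_hasStrictDerivAt a t).hasDerivAt
  have hI0 : ∀ t, a ≤ t → 0 ≤ ∫ x in a..t, F x := fun t ht =>
    intervalIntegral.integral_nonneg ht fun x _ => hF0 x
  have hE : ∀ t, HasDerivAt (fun t => Real.exp (-K * t)) (Real.exp (-K * t) * (-K * 1)) t :=
    fun t => ((hasDerivAt_id t).const_mul (-K)).exp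
  have hW := fun t => (hE t).mul ((hF t).add ((hI t).const_mul K))
  have hanti : AntitoneOn
      ((fun t => Real.exp (-K * t)) * (F + fun t => K * ∫ x in a..t, F x)) (Ici a) := by
    refine antitoneOn_of_deriv_nonpos (convex_Ici a)
      (fun t _ => (hW t).continuousAt.continuousWithinAt)
      (fun t _ => (hW t).differentiableAt.differentiableWithinAt) fun t ht => ?_
    rw [interior_Ici] at ht
    have ht : a ≤ t := le_of_lt ht
    rw [(hW t).deriv]
    simp only [Pi.add_apply]
    have h1 := hD t ht
    have h2 := mul_nonneg (mul_nonneg (zero_le_one.trans hK) (sub_nonneg.2 hK)) (hI0 t ht)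
    have h3 : Real.exp (-K * t) * (D t + K * F t - K * (F t + K * ∫ x in a..t, F x)) ≤ 0 :=
      mul_nonpos_of_nonneg_of_nonpos (Real.exp_pos _).le (by nlinarith)
    linarith
  have h := hanti self_mem_Ici ht ht
  simp only [Pi.mul_apply, Pi.add_apply, ha, intervalIntegral.integral_same, mul_zero,
    add_zero] at h
  have h1 := nonpos_of_mul_nonpos_right h (Real.exp_pos _)
  have h2 := mul_nonneg (zero_le_one.trans hK) (hI0 t ht)
  linarith [hF0 t]

theorem exists_coe_eq_of_le (θ : S1) (a : ℝ) : ∃ t : ℝ, a ≤ t ∧ (t : S1) = θ := by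
  induction θ using QuotientAddGroup.induction_on with | _ b
  obtain ⟨n, hn⟩ := exists_nat_ge ((a - b) / (2 * Real.pi))
  refine ⟨b + n • (2 * Real.pi), ?_, ?_⟩
  · rw [div_le_iff₀ Real.two_pi_pos] at hn
    rw [nsmul_eq_mul]
    linarith
  · rw [AddCircle.coe_add, AddCircle.coe_nsmul, AddCircle.coe_period, smul_zero, add_zero]

/-- A nonnegative eigenfunction of `𝒜` is bounded, and bounded away from `0`. -/
theorem IsEigenpair.exists_bounds {A : S1 → ℝ} (hA_bdd : ∃ C : ℝ, ∀ θ, |A θ| ≤ C) {lam : ℝ}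
    {e : X} (he : IsEigenpair A lam e) (he_nonneg : ∀ᵐ θ, 0 ≤ e θ) :
    ∃ c C : ℝ, 0 < c ∧ ∀ᵐ θ, c ≤ e θ ∧ e θ ≤ C := by
  obtain ⟨C, hC⟩ := hA_bdd
  obtain ⟨hne, hdom, heq⟩ := he
  obtain ⟨f', f'', h1, h2, h3⟩ := op_apply_mem_opGraph A ⟨e, hdom⟩
  rw [heq] at h3
  obtain ⟨F, heF, hF⟩ := h1.exists_isPrimitive
  obtain ⟨D, hfD, hD⟩ := h2.exists_isPrimitive
  have hcoe : Continuous fun t : ℝ => (t : S1) := AddCircle.continuous_mk' _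
  have hderiv : ∀ t : ℝ, HasDerivAt (fun t : ℝ => F (t : S1)) (D (t : S1)) t := by
    intro t
    have e : (fun t : ℝ => F (t : S1)) =
        fun t : ℝ => F ((0 : ℝ) : S1) + ∫ x in (0 : ℝ)..t, D (x : S1) := by
      ext t
      rw [← intervalIntegral.integral_congr_ae ((ae_coe_of_ae hfD).mono fun x hx _ => hx),
        ← hF 0 t]
      ring
    rw [e]
    exact (((D.continuous.comp hcoe).integral_hasStrictDerivAt 0 t).hasDerivAt).const_add _
  have hF0 : ∀ θ, 0 ≤ F θ := by
    have hopen : IsOpen {θ | F θ < 0} := isOpen_lt F.continuous continuous_const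
    have hnull : volume {θ | F θ < 0} = 0 := by
      have : ∀ᵐ θ, ¬ F θ < 0 := by
        filter_upwards [heF, he_nonneg] with θ a b
        rw [← a]
        exact not_lt.2 b
      simpa [ae_iff] using this
    have hemp := hopen.eq_empty_of_measure_zero hnull
    intro θ
    by_contra hθ
    exact (Set.eq_empty_iff_forall_notMem.1 hemp θ) (not_le.1 hθ)
  have hpos : ∀ θ, 0 < F θ := by
    intro θ
    refine lt_of_le_of_ne (hF0 θ) fun hθ => hne ?_
    induction θ using QuotientAddGroup.induction_on with | _ a
    have ha : F (a : S1) = 0 := hθ.symm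
    -- `F` has a minimum at its zero `a`
    have hDa : D (a : S1) = 0 :=
      IsLocalMin.hasDerivAt_eq_zero (.of_forall fun t => by rw [ha]; exact hF0 _) (hderiv a)
    set K : ℝ := |lam| + C + 1
    have hC0 : 0 ≤ C := (abs_nonneg _).trans (hC (a : S1))
    have hbound : ∀ᵐ t : ℝ, f'' (t : S1) ≤ K * F (t : S1) := by
      refine ae_coe_of_ae (P := fun θ => f'' θ ≤ K * F θ) ?_
      filter_upwards [h3, heF, Lp.coeFn_smul lam e] with θ p q r
      rw [r, Pi.smul_apply, smul_eq_mul] at p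
      have hp : lam * e θ = f'' θ + A θ * e θ := p
      rw [q] at hp
      have := mul_le_mul_of_nonneg_right (le_abs_self lam) (hF0 θ)
      have := mul_le_mul_of_nonneg_right ((neg_le_abs (A θ)).trans (hC θ)) (hF0 θ)
      have := hF0 θ
      simp only [K]
      linarith
    have hzero : ∀ t : ℝ, a ≤ t → F (t : S1) = 0 := fun t ht =>
      eq_zero_of_deriv_le_mul_integral (F := fun t : ℝ => F (t : S1))
        (D := fun t : ℝ => D (t : S1)) (K := K)
        (by simp only [K]; linarith [abs_nonneg lam])
        (F.continuous.comp hcoe) (fun t => hF0 _) hderiv ha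
        (fun t ht => by
          have h := hD a t
          rw [hDa, sub_zero] at h
          rw [h, ← intervalIntegral.integral_const_mul]
          refine intervalIntegral.integral_mono_ae ht
            (intervalIntegrable_coe (integrable_coeFn f'') a t)
            ((continuous_const.mul (F.continuous.comp hcoe)).intervalIntegrable a t) hbound) ht
    refine Lp.ext ?_
    filter_upwards [heF, Lp.coeFn_zero ℝ 2 (volume : Measure S1)] with θ p q
    obtain ⟨t, hat, rfl⟩ := exists_coe_eq_of_le θ a
    rw [p, q, hzero t hat, Pi.zero_apply]
  obtain ⟨θ₀, -, hmin⟩ := isCompact_univ.exists_isMinOn univ_nonempty F.continuous.continuousOn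
  refine ⟨F θ₀, ‖F‖, hpos θ₀, ?_⟩
  filter_upwards [heF] with θ p
  rw [p]
  exact ⟨hmin (mem_univ θ), (le_abs_self _).trans (F.norm_coe_le_norm θ)⟩

/-! ### The Hamiltonian -/

/-- The pointwise Legendre inequality behind the Hamiltonian, with the rate `w` normalized by its
optimal value. It is the tangent line inequality at `w = 1`. -/
theorem rpow_div_sub_le {σ w : ℝ} (hσ : 0 < σ) (hσ1 : σ ≠ 1) (hw : 0 < w ∨ 0 ≤ w ∧ σ < 1) :
    w ^ (1 - σ) / (1 - σ) - w ≤ σ / (1 - σ) := by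
  rcases lt_or_gt_of_ne hσ1 with h | h
  · have hw0 : 0 ≤ w := hw.elim le_of_lt And.left
    have h1 := rpow_one_add_le_one_add_mul_self (s := w - 1) (p := 1 - σ) (by linarith)
      (by linarith) (by linarith)
    rw [add_sub_cancel] at h1
    have hs : 0 < 1 - σ := by linarith
    rw [sub_le_iff_le_add, div_le_iff₀ hs, add_mul, div_mul_cancel₀ _ hs.ne']
    linarith
  · have hw0 : 0 < w := hw.elim id fun h' => absurd h'.2 (not_lt.2 h.le)
    have h1 : 1 + (1 - σ) * (w - 1) ≤ w ^ (1 - σ) := by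
      rw [Real.rpow_def_of_pos hw0]
      have := Real.add_one_le_exp (Real.log w * (1 - σ))
      nlinarith [Real.log_le_sub_one_of_pos hw0]
    have hs : 1 - σ < 0 := by linarith
    rw [sub_le_iff_le_add, div_le_iff_of_neg hs, add_mul, div_mul_cancel₀ _ hs.ne]
    linarith

theorem rpow_neg_inv_rpow {σ p : ℝ} (hσ : 0 < σ) (hp : 0 < p) :
    (p ^ (-(1 / σ))) ^ (1 - σ) = p ^ (1 - 1 / σ) := by
  rw [← Real.rpow_mul hp.le]
  congr 1
  field_simp
  ring

theorem rpow_neg_inv_mul {σ p : ℝ} (hp : 0 < p) : p ^ (-(1 / σ)) * p = p ^ (1 - 1 / σ) := by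
  nth_rw 2 [← Real.rpow_one p]
  rw [← Real.rpow_add hp]
  congr 1
  ring

/-- The Legendre transform of `u ↦ u^{1-σ}/(1-σ)` is at most `σ/(1-σ) p^{1-1/σ}`. -/
theorem rpow_div_sub_mul_le {σ u p : ℝ} (hσ : 0 < σ) (hσ1 : σ ≠ 1) (hp : 0 < p)
    (hu : 0 < u ∨ 0 ≤ u ∧ σ < 1) :
    u ^ (1 - σ) / (1 - σ) - u * p ≤ σ / (1 - σ) * p ^ (1 - 1 / σ) := by
  set q : ℝ := p ^ (-(1 / σ)) with hq
  have hq0 : 0 < q := Real.rpow_pos_of_pos hp _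
  have hw : 0 < u / q ∨ 0 ≤ u / q ∧ σ < 1 :=
    hu.imp (fun h => div_pos h hq0) fun h => ⟨div_nonneg h.1 hq0.le, h.2⟩
  have hw0 : 0 ≤ u / q := hw.elim le_of_lt And.left
  have h := mul_le_mul_of_nonneg_right (rpow_div_sub_le hσ hσ1 hw)
    (Real.rpow_nonneg hp.le (1 - 1 / σ))
  have e1 : u ^ (1 - σ) = (u / q) ^ (1 - σ) * p ^ (1 - 1 / σ) := by
    rw [← rpow_neg_inv_rpow hσ hp, ← Real.mul_rpow hw0 hq0.le, div_mul_cancel₀ _ hq0.ne']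
  have e2 : u * p = u / q * p ^ (1 - 1 / σ) := by
    rw [← rpow_neg_inv_mul hp, ← hq, ← mul_assoc, div_mul_cancel₀ _ hq0.ne']
  rw [e1, e2]
  refine le_of_eq_of_le ?_ h
  ring

theorem aemeasurable_coeFn (f : X) : AEMeasurable (f : S1 → ℝ) :=
  (Lp.aestronglyMeasurable f).aemeasurable

theorem rpow_le_add_rpow {a b x : ℝ} (ha : 0 < a) (hax : a ≤ x) (hxb : x ≤ b) (s : ℝ) :
    x ^ s ≤ a ^ s + b ^ s := by
  have hx := ha.trans_le hax
  rcases le_total 0 s with hs | hs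
  · linarith [Real.rpow_le_rpow hx.le hxb hs, Real.rpow_pos_of_pos ha s]
  · linarith [Real.rpow_le_rpow_of_nonpos ha hax hs, Real.rpow_pos_of_pos (hx.trans_le hxb) s]

/-- Powers of a function bounded above and away from `0` are bounded. -/
theorem memLp_rpow {p : X} {c C : ℝ} (hc : 0 < c) (hp : ∀ᵐ θ, c ≤ p θ ∧ p θ ≤ C) (s : ℝ)
    (q : ℝ≥0∞) : MemLp (fun θ => p θ ^ s) q (volume : Measure S1) := by
  refine MemLp.of_bound (C := c ^ s + C ^ s)
    ((aemeasurable_coeFn p).pow_const s).aestronglyMeasurable ?_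
  filter_upwards [hp] with θ h
  rw [Real.norm_of_nonneg (Real.rpow_nonneg (hc.le.trans h.1) s)]
  exact rpow_le_add_rpow hc h.1 h.2 s

theorem integrable_mul_of_bounded {N : S1 → ℝ} (hN : Measurable N)
    (hN_bdd : ∃ C : ℝ, ∀ θ, N θ ≤ C) (hN_nonneg : ∀ θ, 0 ≤ N θ) {f : S1 → ℝ}
    (hf : Integrable f) : Integrable fun θ => f θ * N θ := by
  obtain ⟨C, hC⟩ := hN_bdd
  refine hf.mul_bdd (c := C) hN.aestronglyMeasurable (.of_forall fun θ => ?_)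
  rw [Real.norm_of_nonneg (hN_nonneg θ)]
  exact hC θ

/-- The value `0 ^ (1 - σ)` of the real power differs from the one used in `Ψ` when `σ > 1`, so
the points with `u = 0` and `N ≠ 0` are excluded in that case. -/
theorem ofReal_rpow_mul_ofReal {σ u n : ℝ} (hu : 0 ≤ u) (h : 0 < u ∨ n = 0 ∨ σ < 1) :
    ENNReal.ofReal u ^ (1 - σ) * ENNReal.ofReal n = ENNReal.ofReal (u ^ (1 - σ) * n) := by
  rcases h with h | h | h
  · rw [ENNReal.ofReal_rpow_of_pos h, ENNReal.ofReal_mul (Real.rpow_nonneg hu _)]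
  · simp [h]
  · rw [ENNReal.ofReal_rpow_of_nonneg hu (by linarith), ENNReal.ofReal_mul (Real.rpow_nonneg hu _)]

theorem utility_eq_coe {σ : ℝ} {N : S1 → ℝ} (hN_nonneg : ∀ θ, 0 ≤ N θ) {u : X}
    (hu : ∀ᵐ θ, 0 ≤ u θ ∧ (0 < u θ ∨ N θ = 0 ∨ σ < 1))
    (hint : Integrable fun θ => u θ ^ (1 - σ) * N θ) :
    utility σ N u = ((1 / (1 - σ) * ∫ θ, u θ ^ (1 - σ) * N θ : ℝ) : EReal) := by
  have hnn : 0 ≤ᵐ[volume] fun θ => u θ ^ (1 - σ) * N θ :=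
    hu.mono fun θ h => mul_nonneg (Real.rpow_nonneg h.1 _) (hN_nonneg θ)
  have e : (∫⁻ θ, ENNReal.ofReal (u θ) ^ (1 - σ) * ENNReal.ofReal (N θ)) =
      ENNReal.ofReal (∫ θ, u θ ^ (1 - σ) * N θ) := by
    rw [ofReal_integral_eq_lintegral_ofReal hint hnn]
    exact lintegral_congr_ae (hu.mono fun θ h => ofReal_rpow_mul_ofReal h.1 h.2)
  rw [utility, e, EReal.coe_ennreal_ofReal, max_eq_left (integral_nonneg_of_ae hnn), EReal.coe_mul]

/-- Either the power utility of `u` is a convergent integral, or it is `-∞`. -/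
theorem utility_eq_bot_or {σ : ℝ} (hσ : 0 < σ) (hσ1 : σ ≠ 1) {N : S1 → ℝ} (hN : Measurable N)
    (hN_bdd : ∃ C : ℝ, ∀ θ, N θ ≤ C) (hN_nonneg : ∀ θ, 0 ≤ N θ) {u : X} (hu : u ∈ posCone) :
    utility σ N u = ⊥ ∨ (∀ᵐ θ, 0 ≤ u θ ∧ (0 < u θ ∨ N θ = 0 ∨ σ < 1)) ∧
      Integrable fun θ => u θ ^ (1 - σ) * N θ := by
  have hu : ∀ᵐ θ, 0 ≤ u θ := hu
  have hmeas : AEMeasurable fun θ => u θ ^ (1 - σ) * N θ :=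
    ((aemeasurable_coeFn u).pow_const _).mul hN.aemeasurable
  rcases lt_or_gt_of_ne hσ1 with h | h
  · refine Or.inr ⟨hu.mono fun θ hθ => ⟨hθ, Or.inr (Or.inr h)⟩, ?_⟩
    refine integrable_mul_of_bounded hN hN_bdd hN_nonneg ?_
    refine ((integrable_const (1 : ℝ)).add (integrable_coeFn u)).mono'
      ((aemeasurable_coeFn u).pow_const _).aestronglyMeasurable ?_
    filter_upwards [hu] with θ hθ
    rw [Real.norm_of_nonneg (Real.rpow_nonneg hθ _), Pi.add_apply]
    have h1 := rpow_one_add_le_one_add_mul_self (s := u θ - 1) (p := 1 - σ) (by linarith)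
      (by linarith) (by linarith)
    rw [add_sub_cancel] at h1
    nlinarith
  · by_cases htop : (∫⁻ θ, ENNReal.ofReal (u θ) ^ (1 - σ) * ENNReal.ofReal (N θ)) = ⊤
    · left
      rw [utility, htop, EReal.coe_ennreal_top, EReal.coe_mul_top_of_neg]
      exact one_div_neg.2 (by linarith)
    · right
      have hpos : ∀ᵐ θ, 0 ≤ u θ ∧ (0 < u θ ∨ N θ = 0 ∨ σ < 1) := by
        have hm : AEMeasurable fun θ => ENNReal.ofReal (u θ) ^ (1 - σ) * ENNReal.ofReal (N θ) :=
          ((aemeasurable_coeFn u).ennreal_ofReal.pow_const _).mul hN.ennreal_ofReal.aemeasurable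
        filter_upwards [hu, ae_lt_top' hm htop] with θ h0 hlt
        refine ⟨h0, ?_⟩
        by_contra hcon
        push Not at hcon
        obtain ⟨hu', hN', -⟩ := hcon
        have hNpos : 0 < N θ := lt_of_le_of_ne (hN_nonneg θ) (Ne.symm hN')
        rw [le_antisymm hu' h0, ENNReal.ofReal_zero, ENNReal.zero_rpow_of_neg (by linarith),
          ENNReal.top_mul (by simpa using hNpos)] at hlt
        exact lt_irrefl _ hlt
      refine ⟨hpos, ?_⟩
      rw [← lintegral_ofReal_ne_top_iff_integrable hmeas.aestronglyMeasurable
        (hpos.mono fun θ h => mul_nonneg (Real.rpow_nonneg h.1 _) (hN_nonneg θ))]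
      rwa [← lintegral_congr_ae (hpos.mono fun θ h => ofReal_rpow_mul_ofReal h.1 h.2)]

/-- The supremum in the Hamiltonian is attained at `u = p^{-1/σ}`, which belongs to `X` because
`p` is bounded away from `0`. -/
theorem hamiltonian_eq {σ : ℝ} (hσ : 0 < σ) (hσ1 : σ ≠ 1) {N : S1 → ℝ} (hN : Measurable N)
    (hN_bdd : ∃ C : ℝ, ∀ θ, N θ ≤ C) (hN_nonneg : ∀ θ, 0 ≤ N θ) {p : X} {c C : ℝ} (hc : 0 < c)
    (hp : ∀ᵐ θ, c ≤ p θ ∧ p θ ≤ C) :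
    hamiltonian σ N p = ((σ / (1 - σ) * ∫ θ, p θ ^ (1 - 1 / σ) * N θ : ℝ) : EReal) := by
  have hs : 1 - σ ≠ 0 := sub_ne_zero.2 hσ1.symm
  have hpint : Integrable fun θ => p θ ^ (1 - 1 / σ) * N θ :=
    integrable_mul_of_bounded hN hN_bdd hN_nonneg
      ((memLp_rpow hc hp (1 - 1 / σ) 1).integrable le_rfl)
  have huint : ∀ u : X, Integrable fun θ => u θ * N θ * p θ := by
    intro u
    refine (integrable_mul_of_bounded hN hN_bdd hN_nonneg (integrable_coeFn u)).mul_bdd (c := C)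
      (Lp.aestronglyMeasurable p) ?_
    filter_upwards [hp] with θ h
    rw [Real.norm_of_nonneg (hc.le.trans h.1)]
    exact h.2
  refine le_antisymm (iSup₂_le fun u hu => ?_) ?_
  · rcases utility_eq_bot_or hσ hσ1 hN hN_bdd hN_nonneg hu with h | ⟨hpos, hint⟩
    · rw [h, EReal.bot_sub]
      exact bot_le
    · rw [utility_eq_coe hN_nonneg hpos hint, ← EReal.coe_sub, EReal.coe_le_coe_iff,
        ← integral_const_mul, ← integral_const_mul, ← integral_sub (hint.const_mul _) (huint u)]
      refine integral_mono_ae ((hint.const_mul _).sub (huint u)) (hpint.const_mul _) ?_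
      filter_upwards [hpos, hp] with θ h h'
      have key : N θ = 0 ∨ (0 < u θ ∨ 0 ≤ u θ ∧ σ < 1) := by
        rcases h.2 with h1 | h1 | h1
        · exact Or.inr (Or.inl h1)
        · exact Or.inl h1
        · exact Or.inr (Or.inr ⟨h.1, h1⟩)
      rcases key with h0 | h0
      · simp [h0]
      · have := mul_le_mul_of_nonneg_right
          (rpow_div_sub_mul_le hσ hσ1 (hc.trans_le h'.1) h0) (hN_nonneg θ)
        calc 1 / (1 - σ) * (u θ ^ (1 - σ) * N θ) - u θ * N θ * p θ
            = (u θ ^ (1 - σ) / (1 - σ) - u θ * p θ) * N θ := by ring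
          _ ≤ _ := this
          _ = _ := by ring
  · have hmem : MemLp (fun θ => p θ ^ (-(1 / σ))) 2 (volume : Measure S1) := memLp_rpow hc hp _ 2
    have hu : ∀ᵐ θ, hmem.toLp _ θ = p θ ^ (-(1 / σ)) := hmem.coeFn_toLp
    have hupos : ∀ᵐ θ, 0 < hmem.toLp _ θ := by
      filter_upwards [hu, hp] with θ h h'
      rw [h]
      exact Real.rpow_pos_of_pos (hc.trans_le h'.1) _
    have hcone : hmem.toLp _ ∈ posCone := hupos.mono fun θ h => h.le
    have e1 : (fun θ => hmem.toLp _ θ ^ (1 - σ) * N θ) =ᵐ[volume]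
        fun θ => p θ ^ (1 - 1 / σ) * N θ := by
      filter_upwards [hu, hp] with θ h h'
      rw [h, rpow_neg_inv_rpow hσ (hc.trans_le h'.1)]
    have e2 : (fun θ => hmem.toLp _ θ * N θ * p θ) =ᵐ[volume]
        fun θ => p θ ^ (1 - 1 / σ) * N θ := by
      filter_upwards [hu, hp] with θ h h'
      rw [h, ← rpow_neg_inv_mul (hc.trans_le h'.1)]
      ring
    refine le_iSup₂_of_le (hmem.toLp _) hcone ?_
    rw [utility_eq_coe hN_nonneg (hupos.mono fun θ h => ⟨h.le, Or.inl h⟩) (hpint.congr e1.symm),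
      integral_congr_ae e1, integral_congr_ae e2, ← EReal.coe_sub, EReal.coe_le_coe_iff]
    refine le_of_eq ?_
    field_simp
    ring

/-! ### The explicit solution -/

theorem hasGradientAt_inner_rpow_div {E : Type*} [NormedAddCommGroup E] [InnerProductSpace ℝ E]
    [CompleteSpace E] {s : ℝ} (hs : s ≠ 0) (b : E) {x : E} (hx : 0 < (inner ℝ x b : ℝ)) :
    HasGradientAt (fun x : E => (inner ℝ x b : ℝ) ^ s / s) ((inner ℝ x b : ℝ) ^ (s - 1) • b) x := by
  rw [hasGradientAt_iff_hasFDerivAt]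
  have h1 : HasFDerivAt (fun x : E => (inner ℝ x b : ℝ)) (InnerProductSpace.toDual ℝ E b) x := by
    rw [show (fun x : E => (inner ℝ x b : ℝ)) = InnerProductSpace.toDual ℝ E b from
      funext fun x => real_inner_comm b x]
    exact (InnerProductSpace.toDual ℝ E b).hasFDerivAt
  have h2 := ((Real.hasDerivAt_rpow_const (p := s) (Or.inl hx.ne')).div_const s).comp_hasFDerivAt
    x h1
  refine h2.congr_fderiv ?_
  rw [mul_div_cancel_left₀ _ hs, map_smulₛₗ]
  rfl

theorem weightIntegral_pos {σ : ℝ} {N : S1 → ℝ} (hN_nonneg : ∀ θ, 0 ≤ N θ)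
    (hN_ne : ¬ ∀ᵐ θ, N θ = 0) {e₀ : X} (he₀_pos : ∀ᵐ θ, 0 < e₀ θ)
    (hint : Integrable fun θ => e₀ θ ^ (1 - 1 / σ) * N θ) : 0 < weightIntegral σ N e₀ := by
  have hnn : 0 ≤ᵐ[volume] fun θ => e₀ θ ^ (1 - 1 / σ) * N θ :=
    he₀_pos.mono fun θ h => mul_nonneg (Real.rpow_nonneg h.le _) (hN_nonneg θ)
  refine lt_of_le_of_ne (integral_nonneg_of_ae hnn) fun h => hN_ne ?_
  filter_upwards [(integral_eq_zero_iff_of_nonneg_ae hnn hint).1 h.symm, he₀_pos] with θ h1 h2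
  exact (mul_eq_zero.1 h1).resolve_left (Real.rpow_pos_of_pos h2 _).ne'

theorem IsEigenpair.smul_mem {A : S1 → ℝ} {lam : ℝ} {e : X} (he : IsEigenpair A lam e) (r : ℝ) :
    ∃ h : r • e ∈ (op A).domain, op A ⟨r • e, h⟩ = lam • (r • e) := by
  obtain ⟨-, hdom, heq⟩ := he
  refine ⟨Submodule.smul_mem _ r hdom, ?_⟩
  have h := (op A).map_smul r ⟨e, hdom⟩
  rw [heq, smul_comm] at h
  exact h

theorem IsEigenpair.smul_mem_adjoint {A : S1 → ℝ} (hA : Measurable A)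
    (hA_bdd : ∃ C : ℝ, ∀ θ, |A θ| ≤ C) {lam : ℝ} {e : X} (he : IsEigenpair A lam e) (r : ℝ) :
    ∃ h : r • e ∈ (op A).adjoint.domain, (op A).adjoint ⟨r • e, h⟩ = lam • (r • e) := by
  obtain ⟨h, heq⟩ := he.smul_mem r
  have hle := op_le_adjoint hA hA_bdd
  exact ⟨hle.1 h, (hle.2 (x := ⟨r • e, h⟩) (y := ⟨r • e, hle.1 h⟩) rfl).symm.trans heq⟩

/-- The Hamiltonian at a positive multiple of the eigenfunction. -/
theorem hamiltonian_smul {σ : ℝ} (hσ : 0 < σ) (hσ1 : σ ≠ 1) {N : S1 → ℝ} (hN : Measurable N)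
    (hN_bdd : ∃ C : ℝ, ∀ θ, N θ ≤ C) (hN_nonneg : ∀ θ, 0 ≤ N θ) {e₀ : X} {c C : ℝ} (hc : 0 < c)
    (he₀ : ∀ᵐ θ, c ≤ e₀ θ ∧ e₀ θ ≤ C) {r : ℝ} (hr : 0 < r) :
    hamiltonian σ N (r • e₀) =
      ((σ / (1 - σ) * (r ^ (1 - 1 / σ) * weightIntegral σ N e₀) : ℝ) : EReal) := by
  have hcoe : ∀ᵐ θ, (r • e₀ : X) θ = r * e₀ θ := Lp.coeFn_smul r e₀
  rw [hamiltonian_eq hσ hσ1 hN hN_bdd hN_nonneg (mul_pos hr hc) (C := r * C), weightIntegral]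
  · congr 2
    rw [← integral_const_mul]
    refine integral_congr_ae ?_
    filter_upwards [hcoe, he₀] with θ h h'
    rw [h, Real.mul_rpow hr.le (hc.le.trans h'.1), mul_assoc]
  · filter_upwards [hcoe, he₀] with θ h h'
    rw [h]
    exact ⟨mul_le_mul_of_nonneg_left h'.1 hr.le, mul_le_mul_of_nonneg_left h'.2 hr.le⟩

/-- The scalar identity to which the equation reduces: with `y = ⟨x, β⟩` and `Dv(x) = y^{-σ} β`,
the constant `α₀` is chosen so that the Hamiltonian contributes
`(ρ - λ₀ (1 - σ)) y^{1-σ} / (1 - σ)`. -/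
theorem hamiltonian_coefficient {ρ σ lam W y : ℝ} (hσ : 0 < σ) (hσ1 : σ ≠ 1) (hy : 0 < y)
    (hW : 0 < W) (hg : lam * (1 - σ) < ρ) :
    σ / (1 - σ) * ((y ^ (-σ) * (σ / (ρ - lam * (1 - σ)) * W) ^ (σ / (1 - σ))) ^ (1 - 1 / σ) * W) =
      (ρ - lam * (1 - σ)) * (y ^ (1 - σ) / (1 - σ)) := by
  have hs : 1 - σ ≠ 0 := sub_ne_zero.2 hσ1.symm
  have hk : 0 < ρ - lam * (1 - σ) := sub_pos.2 hg
  have hB : 0 < σ / (ρ - lam * (1 - σ)) * W := mul_pos (div_pos hσ hk) hW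
  have e1 : -σ * (1 - 1 / σ) = 1 - σ := by
    field_simp
    ring
  have e2 : σ / (1 - σ) * (1 - 1 / σ) = -1 := by
    field_simp
    ring
  rw [Real.mul_rpow (Real.rpow_nonneg hy.le _) (Real.rpow_nonneg hB.le _), ← Real.rpow_mul hy.le,
    ← Real.rpow_mul hB.le, e1, e2, Real.rpow_neg_one]
  field_simp

end SpatialAK

theorem mainTheorem4
    (A N : SpatialAK.S1 → ℝ)
    (hA : Measurable A) (hA_bdd : ∃ C : ℝ, ∀ θ, |A θ| ≤ C)
    (hN : Measurable N) (hN_bdd : ∃ C : ℝ, ∀ θ, N θ ≤ C) (hN_nonneg : ∀ θ, 0 ≤ N θ)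
    (hN_ne : ¬ ∀ᵐ θ, N θ = 0)
    (ρ σ : ℝ) (hρ : 0 < ρ) (hσ : 0 < σ) (hσ1 : σ ≠ 1)
    (lam0 : ℝ) (hlam0 : SpatialAK.IsPrincipalEigenvalue A lam0)
    (e₀ : SpatialAK.X) (he₀ : SpatialAK.IsEigenpair A lam0 e₀)
    (he₀_norm : ‖e₀‖ = 1) (he₀_pos : ∀ᵐ θ, 0 < e₀ θ)
    (hgrowth : lam0 * (1 - σ) < ρ) :
    -- the integral in the definition of `α₀` converges, and `β` is positive
    Integrable (fun η => e₀ η ^ (1 - 1 / σ) * N η) ∧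
    (∀ᵐ θ, 0 < SpatialAK.beta ρ σ lam0 N e₀ θ) ∧
    -- `v` is a classical solution on the open half-space, which contains `X⁺_{e₀}`
    SpatialAK.posConeOf e₀ ⊆ SpatialAK.halfSpace e₀ ∧
    IsClassicalHJBSolution ρ (SpatialAK.op A) (fun _ p => SpatialAK.hamiltonian σ N p)
      (SpatialAK.halfSpace e₀) (SpatialAK.explicitSol ρ σ lam0 N e₀) ∧
    -- in particular on `X⁺_{e₀}`, where the equation also holds with `𝒜` in place of its adjoint
    ContDiffOn ℝ 1 (SpatialAK.explicitSol ρ σ lam0 N e₀) (SpatialAK.posConeOf e₀) ∧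
    ∀ x ∈ SpatialAK.posConeOf e₀,
      SolvesHJBAt ρ (SpatialAK.op A) (fun _ p => SpatialAK.hamiltonian σ N p)
        (SpatialAK.explicitSol ρ σ lam0 N e₀) x ∧
      ∃ h : ∇ (SpatialAK.explicitSol ρ σ lam0 N e₀) x ∈ (SpatialAK.op A).domain,
        ((ρ * SpatialAK.explicitSol ρ σ lam0 N e₀ x : ℝ) : EReal) =
          ((inner ℝ x (SpatialAK.op A ⟨∇ (SpatialAK.explicitSol ρ σ lam0 N e₀) x, h⟩) : ℝ) : EReal)
            + SpatialAK.hamiltonian σ N (∇ (SpatialAK.explicitSol ρ σ lam0 N e₀) x) := by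
  obtain ⟨c, C, hc, hbd⟩ := he₀.exists_bounds hA_bdd (he₀_pos.mono fun θ h => h.le)
  have hs : 1 - σ ≠ 0 := sub_ne_zero.2 hσ1.symm
  have hint : Integrable (fun η => e₀ η ^ (1 - 1 / σ) * N η) :=
    SpatialAK.integrable_mul_of_bounded hN hN_bdd hN_nonneg
      ((SpatialAK.memLp_rpow hc hbd (1 - 1 / σ) 1).integrable le_rfl)
  have hW := SpatialAK.weightIntegral_pos hN_nonneg hN_ne he₀_pos hint
  have hα : 0 < SpatialAK.alpha0 ρ σ lam0 N e₀ :=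
    Real.rpow_pos_of_pos (mul_pos (div_pos hσ (sub_pos.2 hgrowth)) hW) _
  set α := SpatialAK.alpha0 ρ σ lam0 N e₀ with hα_def
  set β := SpatialAK.beta ρ σ lam0 N e₀ with hβ_def
  set v := SpatialAK.explicitSol ρ σ lam0 N e₀ with hv_def
  have hβ : β = α • e₀ := rfl
  have hβpos : ∀ᵐ θ, 0 < β θ := by
    have hcoe : ∀ᵐ θ, (α • e₀ : SpatialAK.X) θ = α * e₀ θ := Lp.coeFn_smul α e₀
    filter_upwards [hcoe, he₀_pos] with θ h h'
    rw [hβ, h]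
    exact mul_pos hα h'
  have hy : ∀ x ∈ SpatialAK.halfSpace e₀, 0 < (inner ℝ x β : ℝ) := by
    intro x hx
    rw [hβ, inner_smul_right]
    exact mul_pos hα hx
  have hvy : ∀ x, v x = (inner ℝ x β : ℝ) ^ (1 - σ) / (1 - σ) := fun _ => rfl
  have hgrad : ∀ x ∈ SpatialAK.halfSpace e₀,
      ∇ v x = ((inner ℝ x β : ℝ) ^ (-σ) * α) • e₀ := by
    intro x hx
    have h := (SpatialAK.hasGradientAt_inner_rpow_div hs β (hy x hx)).gradient
    rw [show (1 - σ) - 1 = -σ by ring, hβ, smul_smul] at h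
    exact h
  have hadj : ∀ x ∈ SpatialAK.halfSpace e₀, ∃ h : ∇ v x ∈ (SpatialAK.op A).adjoint.domain,
      (SpatialAK.op A).adjoint ⟨∇ v x, h⟩ = lam0 • ∇ v x := by
    intro x hx
    rw [hgrad x hx]
    exact he₀.smul_mem_adjoint hA hA_bdd _
  have hop : ∀ x ∈ SpatialAK.halfSpace e₀, ∃ h : ∇ v x ∈ (SpatialAK.op A).domain,
      SpatialAK.op A ⟨∇ v x, h⟩ = lam0 • ∇ v x := by
    intro x hx
    rw [hgrad x hx]
    exact he₀.smul_mem _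
  have hcontgrad : Continuous fun x : SpatialAK.halfSpace e₀ => ∇ v (x : SpatialAK.X) := by
    have e : (fun x : SpatialAK.halfSpace e₀ => ∇ v (x : SpatialAK.X)) =
        fun x : SpatialAK.halfSpace e₀ => ((inner ℝ (x : SpatialAK.X) β : ℝ) ^ (-σ) * α) • e₀ :=
      funext fun x => hgrad x x.2
    rw [e]
    refine Continuous.smul (Continuous.mul (Continuous.rpow_const ?_ ?_) continuous_const)
      continuous_const
    · exact continuous_subtype_val.inner continuous_const
    · exact fun x => Or.inl (hy x x.2).ne'
  have hcd : ContDiffOn ℝ 1 v (SpatialAK.halfSpace e₀) := by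
    refine ContDiffOn.div_const (ContDiffOn.rpow_const_of_ne ?_ fun x hx => (hy x hx).ne') _
    exact (contDiff_id.inner ℝ contDiff_const).contDiffOn
  -- both forms of the equation, since `𝒜` and its adjoint agree on `Dv(x)`
  have heqn : ∀ x ∈ SpatialAK.halfSpace e₀, ∀ w : SpatialAK.X, w = lam0 • ∇ v x →
      ((ρ * v x : ℝ) : EReal) = ((inner ℝ x w : ℝ) : EReal) +
        SpatialAK.hamiltonian σ N (∇ v x) := by
    rintro x hx w rfl
    have hyx := hy x hx
    have hinner : (inner ℝ x (lam0 • ∇ v x) : ℝ) = lam0 * (inner ℝ x β : ℝ) ^ (1 - σ) := by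
      rw [hgrad x hx, mul_smul, ← hβ, inner_smul_right, inner_smul_right,
        show (1 - σ) = -σ + 1 by ring, Real.rpow_add_one hyx.ne']
    rw [hinner, hgrad x hx, SpatialAK.hamiltonian_smul hσ hσ1 hN hN_bdd hN_nonneg hc hbd
      (mul_pos (Real.rpow_pos_of_pos hyx _) hα), hα_def, SpatialAK.alpha0,
      SpatialAK.hamiltonian_coefficient hσ hσ1 hyx hW hgrowth, ← EReal.coe_add, hvy]
    congr 1
    field_simp
    ring
  have hsub : SpatialAK.posConeOf e₀ ⊆ SpatialAK.halfSpace e₀ := fun x hx => hx.2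
  have hsolves : ∀ x ∈ SpatialAK.halfSpace e₀,
      SolvesHJBAt ρ (SpatialAK.op A) (fun _ p => SpatialAK.hamiltonian σ N p) v x :=
    fun x hx => ⟨(hadj x hx).1, heqn x hx _ (hadj x hx).2⟩
  have hopen : IsOpen (SpatialAK.halfSpace e₀) :=
    isOpen_lt continuous_const (continuous_id.inner continuous_const)
  have hclass : MemClassS (SpatialAK.op A) (SpatialAK.halfSpace e₀) v :=
    { isOpen := hopen
      contDiffOn := hcd
      gradient_mem := fun x hx => (hadj x hx).1
      continuous_gradient := hcontgrad
      continuous_adjoint_gradient :=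
        (hcontgrad.const_smul lam0).congr fun x => (hadj x x.2).2.symm }
  exact ⟨hint, hβpos, hsub, ⟨hclass, hsolves⟩, hcd.mono hsub, fun x hx =>
    ⟨hsolves x (hsub hx), (hop x (hsub hx)).1, heqn x (hsub hx) _ (hop x (hsub hx)).2⟩⟩
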